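/- Let $M,K,J\ge 1$, $N=MK$, and write $x\in\mathbb R^N$ in $M$ groups, $x=(x(\omega_1),\dots,x(\omega_M))$ with $x(\omega_m)\in\mathbb R^K$. For a permutation $\sigma$ of $[M]$ put $\sigma(x)=(x(\omega_{\sigma(1)}),\dots,x(\omega_{\sigma(M)}))$, and for $k\in[K]$ let $\vec x_k\in\mathbb R^M$ be the vector of the $k$-th components of the $M$ groups of $x$. Let $\mathcal X\subset\mathbb R^N$ be convex and compact, with $\sigma(x)\in\mathcal X$ for all $x\in\mathcal X$ and all $\sigma$. Let $\theta_1,\dots,\theta_J\in\mathcal X$ be data points with lower bounds $\hat v(\theta_1)\ge\dots\ge\hat v(\theta_J)$, let $L\ge 0$, put $\upsilon_{\max}=\hat v(\theta_1)$ and $\hat v(\theta_{J+1})=-\infty$. For $\upsilon\in(-\infty,\upsilon_{\max}]$ let $\kappa(\upsilon)$ be the unique $j\in[J]$ with $\hat v(\theta_{j+1})<\upsilon\le\hat v(\theta_j)$. For $\mathcal Y\in\{\mathcal X,\mathbb R^N\}$ let $\mathcal U^\dagger_{\mathcal Y}$ be the set of functions $f:\mathcal Y\to\mathbb R$ that are bounded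 and measurable on $\mathcal X$; on $\mathcal Y$ are componentwise non-decreasing, quasiconcave, $L$-Lipschitz for $\|\cdot\|_\infty$, and permutation invariant ($f(\sigma(x))=f(x)$ for all $\sigma$); and satisfy $f(\theta_i)\ge\hat v(\theta_i)$ for all $i\in[J]$. Let $\psi_{\mathcal U^\dagger_{\mathcal Y}}(x)=\inf_{f\in\mathcal U^\dagger_{\mathcal Y}}f(x)$ and $\mathcal A(\psi,\upsilon)=\{x\in\mathcal X:\psi(x)\ge\upsilon\}$. Fix $\upsilon\in(-\infty,\upsilon_{\max}]$ and $j=\kappa(\upsilon)$, and let $\mathcal P_\upsilon$ be the set of all $x\in\mathcal X$ for which there are $p\in\mathbb R^{j}_{\ge0}$, $q\ge0$ and matrices $\rho_1,\dots,\rho_j\in\mathbb R^{M\times M}_{\ge0}$ with $$\sum_{i=1}^{j}\hat v(\theta_i)\,p_i-Lq\ge\upsilon,\qquad \sum_{i=1}^{j}\rho_i^\top(\vec\theta_i)_k-\vec x_k\le q\,\vec 1_M\ \ (k\in[K]),$$ $$\sum_{i=1}^{j}p_i=1,\qquad \vec 1_M^\top\rho_i=p_i\vec 1_M^\top,\quad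 \rho_i\vec 1_M=p_i\vec 1_M\ \ (i\in[j]).$$ Then: 1. For valuations defined on all of $\mathbb R^N$, $\mathcal A(\psi_{\mathcal U^\dagger_{\mathbb R^N}},\upsilon)=\mathcal P_\upsilon$. 2. For valuations defined on $\mathcal X$ only, $\mathcal A(\psi_{\mathcal U^\dagger_{\mathcal X}},\upsilon)\subseteq\mathcal P_\upsilon$, and equality holds if $L=0$, or if $L>0$ and the shifted points $\theta_i-\frac{\hat v(\theta_i)-\upsilon}{L}\vec 1_N$ lie in $\mathcal X$ for all $i\le j$. 3. $\mathcal P_\upsilon$ has polynomial size: it is cut out of $\mathcal X$ by a system of $MK+j(M^2+4M+1)+4$ weak linear inequalities in $x$ and $j(M^2+1)+1$ auxiliary real variables. -/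

import Mathlib

namespace PermInv

/-- Outcomes `x ∈ ℝ^N`, `N = M * K`, written by groups: `x m k` is component `k` of group `m`.
The norm of this type is the infinity norm and its order is the componentwise order. -/
abbrev Outcome (M K : ℕ) : Type := Fin M → Fin K → ℝ

/-- `σ(x) = (x(ω_{σ(1)}), …, x(ω_{σ(M)}))`: the groups are reordered. -/
def permute {M K : ℕ} (σ : Equiv.Perm (Fin M)) (x : Outcome M K) : Outcome M K :=
  fun m => x (σ m)

/-- A set of outcomes that is stable under reordering of the groups. -/
def IsPermStable {M K : ℕ} (X : Set (Outcome M K)) : Prop :=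
  ∀ σ : Equiv.Perm (Fin M), ∀ x ∈ X, permute σ x ∈ X

/-- Bounded measurable functions on `X` (values outside `X` play no role). -/
def BoundedMeasurableOn {M K : ℕ} (X : Set (Outcome M K)) : Set (Outcome M K → ℝ) :=
  {f | (∃ C : ℝ, ∀ x ∈ X, |f x| ≤ C) ∧ Measurable (X.domRestrict f)}

/-- `L`-Lipschitz continuity on `Y` with respect to the infinity norm. -/
def IsLipOn {M K : ℕ} (L : ℝ) (Y : Set (Outcome M K)) (f : Outcome M K → ℝ) : Prop :=
  ∀ x ∈ Y, ∀ y ∈ Y, |f x - f y| ≤ L * ‖x - y‖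

/-- Permutation invariance on `Y`. -/
def IsPermInvOn {M K : ℕ} (Y : Set (Outcome M K)) (f : Outcome M K → ℝ) : Prop :=
  ∀ σ : Equiv.Perm (Fin M), ∀ x ∈ Y, f x = f (permute σ x)

/-- The permutation invariant ambiguity set for valuations defined on `Y ⊇ X`: functions that are
bounded and measurable on `X`; monotone, quasiconcave, permutation invariant and `L`-Lipschitz on
`Y`; and with value at least `v i` at each data point `θ i`.  With `Y = X` these are valuations
`X → ℝ`, with `Y = univ` they are valuations defined for all outcomes. -/
def ambiguitySet {M K J : ℕ} (X Y : Set (Outcome M K)) (θ : Fin J → Outcome M K) (v : Fin J → ℝ)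
    (L : ℝ) : Set (Outcome M K → ℝ) :=
  {f | f ∈ BoundedMeasurableOn X ∧ MonotoneOn f Y ∧ QuasiconcaveOn ℝ Y f ∧ IsPermInvOn Y f ∧
    IsLipOn L Y f ∧ ∀ i, v i ≤ f (θ i)}

/-- The worst-case valuation `ψ_F(x) = inf_{f ∈ F} f(x)`. -/
noncomputable def worstCase {M K : ℕ} (F : Set (Outcome M K → ℝ)) (x : Outcome M K) : ℝ :=
  ⨅ f : F, (f : Outcome M K → ℝ) x

/-- The upper level set `{x ∈ X : f(x) ≥ υ}`. -/
def upperLevelSet {M K : ℕ} (X : Set (Outcome M K)) (f : Outcome M K → ℝ) (υ : ℝ) :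
    Set (Outcome M K) :=
  {x | x ∈ X ∧ υ ≤ f x}

/-- The largest lower bound in the data. -/
noncomputable def levelMax {J : ℕ} (v : Fin J → ℝ) : ℝ := ⨆ i, v i

/-- Level selection: the indices `j` with `v (j+1) < υ ≤ v j`, where the value after the last one
is read as `-∞`. -/
def levelSelection {J : ℕ} (v : Fin J → ℝ) (υ : ℝ) : Set (Fin J) :=
  {j | υ ≤ v j ∧ ∀ h : (j : ℕ) + 1 < J, v ⟨j + 1, h⟩ < υ}

/-- Indices of the data points up to and including index `j`; there are `j + 1` of them, since
indices start at `0`. -/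
abbrev Top {J : ℕ} (j : Fin J) : Type := {i : Fin J // i ≤ j}

/-- The linear system in the weights `p`, the scalar `q` and the matrices `ρ`, for a given `x`. -/
structure IsFeasible {M K J : ℕ} (θ : Fin J → Outcome M K) (v : Fin J → ℝ) (L υ : ℝ) (j : Fin J)
    (x : Outcome M K) (p : Top j → ℝ) (q : ℝ) (ρ : Top j → Matrix (Fin M) (Fin M) ℝ) : Prop where
  level : υ ≤ (∑ i, v i.1 * p i) - L * q
  dominate : ∀ k : Fin K, ∀ l : Fin M,
    (∑ i, (ρ i).transpose.mulVec (fun m => θ i.1 m k)) l - x l k ≤ q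
  p_sum : ∑ i, p i = 1
  p_nonneg : ∀ i, 0 ≤ p i
  q_nonneg : 0 ≤ q
  col_sum : ∀ i, ∀ l, ∑ m, ρ i m l = p i
  row_sum : ∀ i, ∀ m, ∑ l, ρ i m l = p i
  ρ_nonneg : ∀ i, ∀ m l, 0 ≤ ρ i m l

/-- The outcomes in `X` for which the linear system has a solution. -/
def dualPolyhedron {M K J : ℕ} (X : Set (Outcome M K)) (θ : Fin J → Outcome M K) (v : Fin J → ℝ)
    (L υ : ℝ) (j : Fin J) : Set (Outcome M K) :=
  {x | x ∈ X ∧ ∃ p q ρ, IsFeasible θ v L υ j x p q ρ}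

/-- `S` is cut out of `X` by `c` weak linear inequalities, jointly in `x` and in `n` auxiliary
real variables. -/
def HasLinearDescription {M K : ℕ} (X S : Set (Outcome M K)) (n c : ℕ) : Prop :=
  ∃ (A : Outcome M K →ₗ[ℝ] (Fin c → ℝ)) (B : (Fin n → ℝ) →ₗ[ℝ] (Fin c → ℝ)) (b : Fin c → ℝ),
    S = {x | x ∈ X ∧ ∃ u : Fin n → ℝ, A x + B u ≤ b}

/-- The data point `θ i` moved down by `(v i - υ) / L` in every component. -/
noncomputable def shiftedPoint {M K J : ℕ} (θ : Fin J → Outcome M K) (v : Fin J → ℝ) (L υ : ℝ)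
    (i : Fin J) : Outcome M K :=
  fun m k => θ i m k - (v i - υ) / L

/-- On `Y` the infimum that defines the worst-case valuation is a true greatest lower bound of a
nonempty set. -/
theorem isGLB_worstCase {M K J : ℕ} (hJ : 0 < J) {X Y : Set (Outcome M K)} (hY : Convex ℝ Y)
    (θ : Fin J → Outcome M K) (hθ : ∀ i, θ i ∈ Y) (v : Fin J → ℝ) {L : ℝ} (hL : 0 ≤ L)
    {x : Outcome M K} (hx : x ∈ Y) :
    (ambiguitySet X Y θ v L).Nonempty ∧
      IsGLB ((fun f : Outcome M K → ℝ => f x) '' ambiguitySet X Y θ v L)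
        (worstCase (ambiguitySet X Y θ v L) x) := by
  have hne : (ambiguitySet X Y θ v L).Nonempty := by
    refine ⟨fun _ => levelMax v, ⟨⟨|levelMax v|, fun _ _ => le_rfl⟩, measurable_const⟩,
      fun _ _ _ _ _ => le_rfl, fun r => ?_, fun _ _ _ => rfl, fun x _ y _ => ?_, fun i => ?_⟩
    · by_cases h : r ≤ levelMax v <;> simp [h, hY, convex_empty]
    · simpa using mul_nonneg hL (norm_nonneg (x - y))
    · exact le_ciSup (Set.finite_range v).bddAbove i
  refine ⟨hne, ?_⟩
  have hb : BddBelow ((fun f : Outcome M K → ℝ => f x) '' ambiguitySet X Y θ v L) := by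
    refine ⟨v ⟨0, hJ⟩ - L * ‖θ ⟨0, hJ⟩ - x‖, ?_⟩
    rintro _ ⟨f, ⟨_, _, _, _, hlip, hv⟩, rfl⟩
    have h1 := (abs_le.1 (hlip _ (hθ ⟨0, hJ⟩) x hx)).2
    have h2 := hv ⟨0, hJ⟩
    show _ ≤ f x
    linarith
  have h := isGLB_csInf (hne.image _) hb
  rwa [sInf_image'] at h

/-- Exactly one index is selected. -/
theorem existsUnique_levelSelection {J : ℕ} (hJ : 0 < J) {v : Fin J → ℝ} (hv : Antitone v)
    {υ : ℝ} (hυ : υ ≤ levelMax v) : ∃ j, levelSelection v υ = {j} := by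
  have : Nonempty (Fin J) := ⟨⟨0, hJ⟩⟩
  have h0 : ∃ i, υ ≤ v i := by
    obtain ⟨i, hi⟩ := exists_eq_ciSup_of_finite (f := v)
    exact ⟨i, by rw [hi]; exact hυ⟩
  obtain ⟨j, hj, hmax⟩ := (Set.toFinite {i | υ ≤ v i}).exists_maximal h0
  refine ⟨j, ?_⟩
  ext i
  simp only [levelSelection, Set.mem_ofPred_eq, Set.mem_singleton_iff]
  constructor
  · rintro ⟨hi, hi'⟩
    have hij : i ≤ j := by
      rcases le_total i j with h | h
      · exact h
      · exact hmax hi h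
    by_contra hne
    have hlt : (i : ℕ) < j := lt_of_le_of_ne hij (fun h => hne (Fin.ext h))
    have h1 : (i : ℕ) + 1 < J := by omega
    have h2 : v j ≤ v ⟨i + 1, h1⟩ := hv (Fin.mk_le_of_le_val (by omega))
    exact absurd (hi' h1) (not_lt.2 (le_trans hj h2))
  · rintro rfl
    refine ⟨hj, fun h => ?_⟩
    by_contra hcon
    have := hmax (y := ⟨i + 1, h⟩) (not_lt.1 hcon) (Fin.le_def.2 (by simp))
    have := Fin.le_def.1 this
    simp at this

end PermInv

/-!
Let `Z` be the convex hull of the pairs `(σ(θ i), v i)` with `i ≤ j` and `σ` a permutation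
(`orbitHull`). By Birkhoff's theorem the weights `p` and matrices `ρ` of the linear system describe
exactly the points of `Z`, so the system is solvable at `x` if and only if there are `(z, w) ∈ Z`
and `q ≥ 0` with `z - x ≤ q` componentwise and `w - L * q ≥ υ` (`exists_isFeasible_iff`).

If the system is solvable at `x` and `f` lies in the ambiguity set, then by the Lipschitz condition
`f ≥ υ` at each `θ i` shifted down by `(v i - υ) / L`, hence at all reorderings of these points and,
by quasiconcavity, on their convex hull. One point of that hull lies below `x`, so `f x ≥ υ` by
monotonicity (`le_of_exists_isFeasible`). Only here do the shifted points have to lie in the domain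
of `f`; for `L = 0` the function `f` is constant and nothing is needed.

Conversely, no duality is required: the function
`hullValue y = max {w - L * excess (z - y) | (z, w) ∈ Z}`, with `excess` the largest positive part
of a component, is concave, monotone, permutation invariant and `L`-Lipschitz, is at least `v i` at
`θ i` for `i ≤ j`, and is at least `υ` exactly where the system is solvable (`le_hullValue_iff`).
The remaining data points have `v i < υ`, so the maximum of `hullValue` with a suitable constant
`c < υ` satisfies all lower bounds. This maximum is still quasiconcave, so it belongs to the
ambiguity set, and it is below `υ` wherever the system has no solution
(`max_hullValue_mem_ambiguitySet`, `upperLevelSet_worstCase_subset`).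
-/

namespace PermInv

variable {M K J : ℕ}

/-! ### Convex hull of the reordered data -/

/-- The convex hull in `Outcome M K × ℝ` of the pairs `(σ(θ i), v i)`, for `i` up to `j` and all
permutations `σ`. -/
def orbitHull (θ : Fin J → Outcome M K) (v : Fin J → ℝ) (j : Fin J) : Set (Outcome M K × ℝ) :=
  convexHull ℝ (Set.range fun s : Top j × Equiv.Perm (Fin M) => (permute s.2 (θ s.1), v s.1))

theorem mem_orbitHull (θ : Fin J → Outcome M K) (v : Fin J → ℝ) {i j : Fin J} (hi : i ≤ j)
    (σ : Equiv.Perm (Fin M)) : (permute σ (θ i), v i) ∈ orbitHull θ v j :=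
  subset_convexHull ℝ _ ⟨(⟨i, hi⟩, σ), rfl⟩

theorem isCompact_orbitHull (θ : Fin J → Outcome M K) (v : Fin J → ℝ) (j : Fin J) :
    IsCompact (orbitHull θ v j) :=
  (Set.finite_range _).isCompact_convexHull ℝ

theorem convex_orbitHull (θ : Fin J → Outcome M K) (v : Fin J → ℝ) (j : Fin J) :
    Convex ℝ (orbitHull θ v j) :=
  convex_convexHull ℝ _

theorem orbitHull_subset {θ : Fin J → Outcome M K} {v : Fin J → ℝ} {j : Fin J}
    {W : Set (Outcome M K × ℝ)} (hW : Convex ℝ W)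
    (h : ∀ i ≤ j, ∀ σ : Equiv.Perm (Fin M), (permute σ (θ i), v i) ∈ W) :
    orbitHull θ v j ⊆ W :=
  convexHull_min (by rintro _ ⟨⟨i, σ⟩, rfl⟩; exact h i.1 i.2 σ) hW

theorem permute_mem_orbitHull {θ : Fin J → Outcome M K} {v : Fin J → ℝ} {j : Fin J}
    {z : Outcome M K × ℝ} (hz : z ∈ orbitHull θ v j) (σ : Equiv.Perm (Fin M)) :
    (permute σ z.1, z.2) ∈ orbitHull θ v j := by
  refine orbitHull_subset (W := {z | (permute σ z.1, z.2) ∈ orbitHull θ v j}) ?_ ?_ hz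
  · intro z hz w hw a b ha hb hab
    exact convex_orbitHull θ v j hz hw ha hb hab
  · intro i hi τ
    exact mem_orbitHull θ v hi (σ.trans τ)

/-! ### Feasible weights and matrices as points of the hull -/

/-- The linear action of a matrix on outcomes that replaces group `l` by the combination of the
groups with the weights in column `l`. -/
def mixGroups (y : Outcome M K) : Matrix (Fin M) (Fin M) ℝ →ₗ[ℝ] Outcome M K where
  toFun A := fun l k => (A.transpose.mulVec fun m => y m k) l
  map_add' A B := by
    funext l k
    simp [Matrix.add_mulVec]
  map_smul' a A := by
    funext l k
    simp [Matrix.smul_mulVec]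

theorem mixGroups_permMatrix (σ : Equiv.Perm (Fin M)) (y : Outcome M K) :
    mixGroups y (σ.permMatrix ℝ) = permute σ⁻¹ y := by
  funext l k
  change ((σ.permMatrix ℝ).transpose.mulVec fun m => y m k) l = _
  rw [Matrix.transpose_permMatrix, Matrix.permMatrix_mulVec]
  rfl

/-- By Birkhoff's theorem a doubly stochastic matrix maps a data point to a convex combination of
its reorderings. -/
theorem mixGroups_mem_orbitHull {θ : Fin J → Outcome M K} {v : Fin J → ℝ} {i j : Fin J}
    (hi : i ≤ j) {A : Matrix (Fin M) (Fin M) ℝ} (hA : A ∈ doublyStochastic ℝ (Fin M)) :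
    (mixGroups (θ i) A, v i) ∈ orbitHull θ v j := by
  rw [← SetLike.mem_coe, doublyStochastic_eq_convexHull_permMatrix] at hA
  refine convexHull_min (t := {A | (mixGroups (θ i) A, v i) ∈ orbitHull θ v j}) ?_ ?_ hA
  · rintro _ ⟨σ, rfl⟩
    rw [Set.mem_ofPred_eq, mixGroups_permMatrix]
    exact mem_orbitHull θ v hi σ⁻¹
  · intro A hA B hB a b ha hb hab
    have heq : (mixGroups (θ i) (a • A + b • B), v i) =
        a • (mixGroups (θ i) A, v i) + b • (mixGroups (θ i) B, v i) :=
      Prod.ext (by simp) (by simp [← add_mul, hab])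
    rw [Set.mem_ofPred_eq, heq]
    exact convex_orbitHull θ v j hA hB ha hb hab

/-- Nonnegative matrices `ρ i` with all row and column sums equal to the convex weights `p i` are
multiples of doubly stochastic matrices, so together they produce a point of the hull. -/
theorem sum_mixGroups_mem_orbitHull {θ : Fin J → Outcome M K} {v : Fin J → ℝ} {j : Fin J}
    {p : Top j → ℝ} {ρ : Top j → Matrix (Fin M) (Fin M) ℝ} (hp : ∑ i, p i = 1)
    (hp0 : ∀ i, 0 ≤ p i) (hcol : ∀ i l, ∑ m, ρ i m l = p i) (hrow : ∀ i m, ∑ l, ρ i m l = p i)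
    (hρ : ∀ i m l, 0 ≤ ρ i m l) :
    (∑ i, mixGroups (θ i.1) (ρ i), ∑ i, v i.1 * p i) ∈ orbitHull θ v j := by
  have h : ∀ i, ∃ D ∈ doublyStochastic ℝ (Fin M), ρ i = p i • D := fun i =>
    (exists_mem_doublyStochastic_eq_smul_iff (hp0 i)).2 ⟨hρ i, hrow i, hcol i⟩
  choose D hD hρD using h
  have heq : (∑ i, mixGroups (θ i.1) (ρ i), ∑ i, v i.1 * p i) =
      ∑ i, p i • (mixGroups (θ i.1) (D i), v i.1) :=
    Prod.ext (by simp only [Prod.fst_sum, Prod.smul_fst, hρD, map_smul])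
      (by simp only [Prod.snd_sum, Prod.smul_snd, smul_eq_mul, mul_comm])
  rw [heq]
  exact (convex_orbitHull θ v j).sum_mem (fun i _ => hp0 i) hp
    fun i _ => mixGroups_mem_orbitHull i.2 (hD i)

/-- The pairs `(z, w)` that come from a family of weights and matrices form a convex set, which
contains each generator `(σ(θ i), v i)` through the permutation matrix of `σ⁻¹`. -/
theorem exists_weights_of_mem_orbitHull {θ : Fin J → Outcome M K} {v : Fin J → ℝ} {j : Fin J}
    {z : Outcome M K × ℝ} (hz : z ∈ orbitHull θ v j) :
    ∃ (p : Top j → ℝ) (ρ : Top j → Matrix (Fin M) (Fin M) ℝ), ∑ i, p i = 1 ∧ (∀ i, 0 ≤ p i) ∧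
      (∀ i l, ∑ m, ρ i m l = p i) ∧ (∀ i m, ∑ l, ρ i m l = p i) ∧ (∀ i m l, 0 ≤ ρ i m l) ∧
      ∑ i, mixGroups (θ i.1) (ρ i) = z.1 ∧
      ∑ i, v i.1 * p i = z.2 := by
  refine orbitHull_subset (W := {z | ∃ (p : Top j → ℝ) (ρ : Top j → Matrix (Fin M) (Fin M) ℝ),
    ∑ i, p i = 1 ∧ (∀ i, 0 ≤ p i) ∧
      (∀ i l, ∑ m, ρ i m l = p i) ∧ (∀ i m, ∑ l, ρ i m l = p i) ∧ (∀ i m l, 0 ≤ ρ i m l) ∧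
      ∑ i, mixGroups (θ i.1) (ρ i) = z.1 ∧
      ∑ i, v i.1 * p i = z.2}) ?_ ?_ hz
  · rintro z ⟨p, ρ, h1, h2, h3, h4, h5, h6, h7⟩ w ⟨p', ρ', h1', h2', h3', h4', h5', h6', h7'⟩
      a b ha hb hab
    refine ⟨a • p + b • p', a • ρ + b • ρ', ?_, fun i => ?_, fun i l => ?_, fun i m => ?_,
      fun i m l => ?_, ?_, ?_⟩
    · simp [Finset.sum_add_distrib, ← Finset.mul_sum, h1, h1', hab]
    · exact add_nonneg (mul_nonneg ha (h2 i)) (mul_nonneg hb (h2' i))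
    · simp [Finset.sum_add_distrib, ← Finset.mul_sum, h3, h3']
    · simp [Finset.sum_add_distrib, ← Finset.mul_sum, h4, h4']
    · exact add_nonneg (mul_nonneg ha (h5 i m l)) (mul_nonneg hb (h5' i m l))
    · simp [Finset.sum_add_distrib, ← Finset.smul_sum, h6, h6']
    · simp [mul_add, Finset.sum_add_distrib, mul_left_comm _ a, mul_left_comm _ b,
        ← Finset.mul_sum, h7, h7']
  · intro i hi σ
    have hD : σ⁻¹.permMatrix ℝ ∈ doublyStochastic ℝ (Fin M) := permMatrix_mem_doublyStochastic
    rw [mem_doublyStochastic_iff_sum] at hD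
    obtain ⟨hD0, hDr, hDc⟩ := hD
    refine ⟨Pi.single ⟨i, hi⟩ 1, Pi.single ⟨i, hi⟩ (σ⁻¹.permMatrix ℝ), by simp, fun i' => ?_,
      fun i' l => ?_, fun i' m => ?_, fun i' m l => ?_, ?_, ?_⟩
    · by_cases h : i' = ⟨i, hi⟩
      · subst h; simp
      · simp [h]
    · by_cases h : i' = ⟨i, hi⟩
      · subst h; simpa only [Pi.single_eq_same] using hDc l
      · simp [h]
    · by_cases h : i' = ⟨i, hi⟩
      · subst h; simpa only [Pi.single_eq_same] using hDr m
      · simp [h]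
    · by_cases h : i' = ⟨i, hi⟩
      · subst h; simpa only [Pi.single_eq_same] using hD0 m l
      · simp [h]
    · rw [Finset.sum_eq_single ⟨i, hi⟩ (fun i' _ h => by simp [h]) (by simp), Pi.single_eq_same,
        mixGroups_permMatrix, inv_inv]
    · rw [Finset.sum_eq_single ⟨i, hi⟩ (fun i' _ h => by simp [h]) (by simp)]
      simp

theorem sum_mixGroups_apply (θ : Fin J → Outcome M K) {j : Fin J}
    (ρ : Top j → Matrix (Fin M) (Fin M) ℝ) (l : Fin M) (k : Fin K) :
    (∑ i, mixGroups (θ i.1) (ρ i)) l k =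
      (∑ i, (ρ i).transpose.mulVec fun m => θ i.1 m k) l := by
  simp only [Finset.sum_apply]
  rfl

theorem exists_isFeasible_iff {θ : Fin J → Outcome M K} {v : Fin J → ℝ} {L υ : ℝ} {j : Fin J}
    {x : Outcome M K} :
    (∃ p q ρ, IsFeasible θ v L υ j x p q ρ) ↔
      ∃ z ∈ orbitHull θ v j, ∃ q, 0 ≤ q ∧ (∀ m k, z.1 m k - x m k ≤ q) ∧ υ ≤ z.2 - L * q := by
  constructor
  · rintro ⟨p, q, ρ, h⟩
    exact ⟨_, sum_mixGroups_mem_orbitHull h.p_sum h.p_nonneg h.col_sum h.row_sum h.ρ_nonneg, q,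
      h.q_nonneg, fun m k => by
        simpa only [sum_mixGroups_apply] using h.dominate k m, h.level⟩
  · rintro ⟨z, hz, q, hq, hd, hl⟩
    obtain ⟨p, ρ, h1, h2, h3, h4, h5, h6, h7⟩ := exists_weights_of_mem_orbitHull hz
    exact ⟨p, q, ρ, by rwa [h7], fun k l => by
      rw [← sum_mixGroups_apply, h6]; exact hd l k, h1, h2, hq, h3, h4, h5⟩

/-! ### Sufficiency of the linear system -/

/-- A solution of the linear system certifies the level `υ` for every valuation in the ambiguity
set: shifting `θ i` down by `(v i - υ) / L` costs at most `v i - υ` in value, and a reordered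
convex combination of the shifted points lies below `x`. -/
theorem le_of_exists_isFeasible {X Y : Set (Outcome M K)} (hYperm : IsPermStable Y)
    {θ : Fin J → Outcome M K} (hθ : ∀ i, θ i ∈ Y) {v : Fin J → ℝ} {L υ : ℝ} (hL : 0 ≤ L)
    {j : Fin J} (hj : ∀ i ≤ j, υ ≤ v i)
    (hshift : 0 < L → ∀ i ≤ j, shiftedPoint θ v L υ i ∈ Y) {f : Outcome M K → ℝ}
    (hf : f ∈ ambiguitySet X Y θ v L) {x : Outcome M K} (hx : x ∈ Y)
    (hfeas : ∃ p q ρ, IsFeasible θ v L υ j x p q ρ) : υ ≤ f x := by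
  obtain ⟨-, hmono, hqc, hperm, hlip, hval⟩ := hf
  rcases hL.eq_or_lt with rfl | hL
  · -- A Lipschitz function with constant `0` takes the same value at `x` and at `θ j`.
    have h := (abs_le.1 (hlip _ (hθ j) x hx)).2
    linarith [hj j le_rfl, hval j]
  obtain ⟨z, hz, q, -, hd, hl⟩ := exists_isFeasible_iff.1 hfeas
  -- Shifting down a point of the hull by the excess of its value over `υ` is an affine map; the
  -- shifted data points lie in the convex upper level set of `f` at `υ`.
  have hmem : orbitHull θ v j ⊆
      {z | (fun m k => z.1 m k - (z.2 - υ) / L : Outcome M K) ∈ {y | y ∈ Y ∧ υ ≤ f y}} := by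
    refine orbitHull_subset ?_ fun i hi σ => ?_
    · intro z hz w hw a b ha hb hab
      have heq : (fun m k => (a • z + b • w).1 m k - ((a • z + b • w).2 - υ) / L :
          Outcome M K) = a • (fun m k => z.1 m k - (z.2 - υ) / L : Outcome M K) +
            b • (fun m k => w.1 m k - (w.2 - υ) / L : Outcome M K) := by
        funext m k
        simp only [Prod.fst_add, Prod.smul_fst, Prod.snd_add, Prod.smul_snd, Pi.add_apply,
          Pi.smul_apply, smul_eq_mul]
        linear_combination -(υ / L) * hab
      rw [Set.mem_ofPred_eq, heq]
      exact hqc υ hz hw ha hb hab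
    · have hs := hshift hL i hi
      have heq : (fun m k => permute σ (θ i) m k - (v i - υ) / L : Outcome M K) =
          permute σ (shiftedPoint θ v L υ i) := rfl
      simp only [Set.mem_ofPred_eq, heq]
      refine ⟨hYperm σ _ hs, ?_⟩
      rw [← hperm σ _ hs]
      have h0 : 0 ≤ (v i - υ) / L := div_nonneg (sub_nonneg.2 (hj i hi)) hL.le
      have hnorm : ‖θ i - shiftedPoint θ v L υ i‖ ≤ (v i - υ) / L := by
        refine (pi_norm_le_iff_of_nonneg h0).2 fun m => (pi_norm_le_iff_of_nonneg h0).2 fun k => ?_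
        simp only [shiftedPoint, Pi.sub_apply, sub_sub_cancel, Real.norm_eq_abs, abs_of_nonneg h0,
          le_refl]
      have h1 := (abs_le.1 (hlip _ (hθ i) _ hs)).2
      have h2 := mul_le_mul_of_nonneg_left hnorm hL.le
      rw [mul_div_cancel₀ _ hL.ne'] at h2
      linarith [hval i]
  obtain ⟨h1, h2⟩ := hmem hz
  refine h2.trans (hmono h1 hx fun m k => ?_)
  have : q ≤ (z.2 - υ) / L := by rw [le_div_iff₀ hL]; linarith
  have := hd m k
  show z.1 m k - (z.2 - υ) / L ≤ x m k
  linarith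

/-! ### A worst-case valuation -/

/-- The largest positive part of a component: the least `q ≥ 0` with `d ≤ q` componentwise. -/
noncomputable def excess (d : Outcome M K) : ℝ := ‖fun m k => max (d m k) 0‖

theorem excess_le_iff {d : Outcome M K} {q : ℝ} (hq : 0 ≤ q) :
    excess d ≤ q ↔ ∀ m k, d m k ≤ q := by
  simp only [excess, pi_norm_le_iff_of_nonneg hq, Real.norm_eq_abs,
    abs_of_nonneg (le_max_right _ (0 : ℝ)), max_le_iff, hq, and_true]

theorem excess_nonneg (d : Outcome M K) : 0 ≤ excess d := norm_nonneg _

theorem le_excess (d : Outcome M K) (m : Fin M) (k : Fin K) : d m k ≤ excess d :=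
  (excess_le_iff (excess_nonneg d)).1 le_rfl m k

theorem continuous_excess : Continuous (excess : Outcome M K → ℝ) := by
  unfold excess
  fun_prop

theorem excess_mono {d e : Outcome M K} (h : d ≤ e) : excess d ≤ excess e :=
  (excess_le_iff (excess_nonneg e)).2 fun m k => (h m k).trans (le_excess e m k)

theorem excess_permute_le (σ : Equiv.Perm (Fin M)) (d : Outcome M K) :
    excess (permute σ d) ≤ excess d :=
  (excess_le_iff (excess_nonneg d)).2 fun m k => le_excess d (σ m) k

theorem excess_le_add_norm (d e : Outcome M K) : excess d ≤ excess e + ‖d - e‖ := by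
  refine (excess_le_iff (add_nonneg (excess_nonneg e) (norm_nonneg _))).2 fun m k => ?_
  have h1 := le_excess e m k
  have h2 := (le_abs_self _).trans ((norm_le_pi_norm ((d - e) m) k).trans (norm_le_pi_norm _ m))
  simp only [Pi.sub_apply] at h2
  linarith

theorem convexOn_excess : ConvexOn ℝ Set.univ (excess : Outcome M K → ℝ) := by
  refine ⟨convex_univ, fun d _ e _ a b ha hb _ => ?_⟩
  simp only [smul_eq_mul]
  refine (excess_le_iff (add_nonneg (mul_nonneg ha (excess_nonneg d))
    (mul_nonneg hb (excess_nonneg e)))).2 fun m k => ?_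
  exact add_le_add (mul_le_mul_of_nonneg_left (le_excess d m k) ha)
    (mul_le_mul_of_nonneg_left (le_excess e m k) hb)

/-- The largest value of `w - L * excess (z - y)` over the points `(z, w)` of the hull: the
smallest permutation invariant, monotone, concave and `L`-Lipschitz function with value at least
`v i` at `θ i` for `i ≤ j`. -/
noncomputable def hullValue (θ : Fin J → Outcome M K) (v : Fin J → ℝ) (L : ℝ) (j : Fin J)
    (y : Outcome M K) : ℝ :=
  sSup ((fun z : Outcome M K × ℝ => z.2 - L * excess (z.1 - y)) '' orbitHull θ v j)

theorem exists_hullValue_eq (θ : Fin J → Outcome M K) (v : Fin J → ℝ) (L : ℝ) (j : Fin J)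
    (y : Outcome M K) :
    ∃ z ∈ orbitHull θ v j, hullValue θ v L j y = z.2 - L * excess (z.1 - y) :=
  (isCompact_orbitHull θ v j).exists_sSup_image_eq ⟨_, mem_orbitHull θ v le_rfl 1⟩ <| by
    have := continuous_excess (M := M) (K := K)
    fun_prop

theorem le_hullValue {θ : Fin J → Outcome M K} {v : Fin J → ℝ} (L : ℝ) {j : Fin J}
    {z : Outcome M K × ℝ} (hz : z ∈ orbitHull θ v j) (y : Outcome M K) :
    z.2 - L * excess (z.1 - y) ≤ hullValue θ v L j y := by
  refine le_csSup ((isCompact_orbitHull θ v j).image ?_).bddAbove ⟨z, hz, rfl⟩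
  have := continuous_excess (M := M) (K := K)
  fun_prop

theorem le_hullValue_apply {θ : Fin J → Outcome M K} {v : Fin J → ℝ} (L : ℝ) {i j : Fin J}
    (hi : i ≤ j) : v i ≤ hullValue θ v L j (θ i) := by
  have h := le_hullValue L (mem_orbitHull θ v hi 1) (θ i)
  have h0 : excess (permute 1 (θ i) - θ i) ≤ 0 :=
    (excess_le_iff le_rfl).2 fun m k => by simp [permute]
  simpa [le_antisymm h0 (excess_nonneg _)] using h

/-- The maximum that defines `hullValue` is attained, so its upper level set is exactly the set
where the linear system is solvable. -/
theorem le_hullValue_iff {θ : Fin J → Outcome M K} {v : Fin J → ℝ} {L υ : ℝ} (hL : 0 ≤ L)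
    {j : Fin J} {y : Outcome M K} :
    υ ≤ hullValue θ v L j y ↔ ∃ p q ρ, IsFeasible θ v L υ j y p q ρ := by
  rw [exists_isFeasible_iff]
  constructor
  · intro h
    obtain ⟨z, hz, hzy⟩ := exists_hullValue_eq θ v L j y
    exact ⟨z, hz, excess (z.1 - y), excess_nonneg _, fun m k => le_excess (z.1 - y) m k,
      hzy ▸ h⟩
  · rintro ⟨z, hz, q, hq, hd, hl⟩
    have h1 : excess (z.1 - y) ≤ q := (excess_le_iff hq).2 hd
    have := mul_le_mul_of_nonneg_left h1 hL
    linarith [le_hullValue L hz y]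

theorem monotone_hullValue (θ : Fin J → Outcome M K) (v : Fin J → ℝ) {L : ℝ} (hL : 0 ≤ L)
    (j : Fin J) : Monotone (hullValue θ v L j) := by
  intro y y' h
  obtain ⟨z, hz, hzy⟩ := exists_hullValue_eq θ v L j y
  rw [hzy]
  refine le_trans ?_ (le_hullValue L hz y')
  gcongr
  exact excess_mono (sub_le_sub_left h _)

theorem concaveOn_hullValue (θ : Fin J → Outcome M K) (v : Fin J → ℝ) {L : ℝ} (hL : 0 ≤ L)
    (j : Fin J) : ConcaveOn ℝ Set.univ (hullValue θ v L j) := by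
  refine ⟨convex_univ, fun y _ y' _ a b ha hb hab => ?_⟩
  obtain ⟨z, hz, hzy⟩ := exists_hullValue_eq θ v L j y
  obtain ⟨z', hz', hzy'⟩ := exists_hullValue_eq θ v L j y'
  refine le_trans ?_ (le_hullValue L (convex_orbitHull θ v j hz hz' ha hb hab) _)
  have h := convexOn_excess.2 (Set.mem_univ (z.1 - y)) (Set.mem_univ (z'.1 - y')) ha hb hab
  have heq : a • (z.1 - y) + b • (z'.1 - y') =
      (a • z + b • z').1 - (a • y + b • y') := by
    simp only [Prod.fst_add, Prod.smul_fst, smul_sub]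
    abel
  rw [heq] at h
  have := mul_le_mul_of_nonneg_left h hL
  simp only [hzy, hzy', Prod.snd_add, Prod.smul_snd, smul_eq_mul] at this ⊢
  linarith

theorem hullValue_le_add_norm (θ : Fin J → Outcome M K) (v : Fin J → ℝ) {L : ℝ} (hL : 0 ≤ L)
    (j : Fin J) (y y' : Outcome M K) :
    hullValue θ v L j y ≤ hullValue θ v L j y' + L * ‖y - y'‖ := by
  obtain ⟨z, hz, hzy⟩ := exists_hullValue_eq θ v L j y
  have h1 := le_hullValue L hz y'
  have h2 := excess_le_add_norm (z.1 - y') (z.1 - y)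
  rw [sub_sub_sub_cancel_left] at h2
  have := mul_le_mul_of_nonneg_left h2 hL
  linarith

theorem hullValue_permute (θ : Fin J → Outcome M K) (v : Fin J → ℝ) {L : ℝ} (hL : 0 ≤ L)
    (j : Fin J) (σ : Equiv.Perm (Fin M)) (y : Outcome M K) :
    hullValue θ v L j (permute σ y) = hullValue θ v L j y := by
  have key : ∀ (τ : Equiv.Perm (Fin M)) (y : Outcome M K),
      hullValue θ v L j y ≤ hullValue θ v L j (permute τ y) := by
    intro τ y
    obtain ⟨z, hz, hzy⟩ := exists_hullValue_eq θ v L j y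
    have h1 := le_hullValue L (permute_mem_orbitHull hz τ) (permute τ y)
    have h2 := mul_le_mul_of_nonneg_left (excess_permute_le τ (z.1 - y)) hL
    have h3 : permute τ (z.1 - y) = permute τ z.1 - permute τ y := rfl
    rw [h3] at h2
    linarith
  refine le_antisymm ?_ (key σ y)
  have h : permute σ⁻¹ (permute σ y) = y := by
    funext m
    simp [permute]
  simpa [h] using key σ⁻¹ (permute σ y)

/-- Cutting `hullValue` off from below at a level `c` keeps it quasiconcave and provides the lower
bounds at the data points after `j`. -/
theorem max_hullValue_mem_ambiguitySet (θ : Fin J → Outcome M K) (v : Fin J → ℝ) {L : ℝ}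
    (hL : 0 ≤ L) (j : Fin J) {X : Set (Outcome M K)} (hX : IsCompact X) {c : ℝ}
    (hc : ∀ i, j < i → v i ≤ c) :
    (fun y => max (hullValue θ v L j y) c) ∈ ambiguitySet X Set.univ θ v L := by
  have hlip : IsLipOn L Set.univ fun y => max (hullValue θ v L j y) c := by
    intro x _ y _
    refine (abs_max_sub_max_le_abs _ _ _).trans (abs_le.2 ⟨?_, ?_⟩)
    · have := hullValue_le_add_norm θ v hL j y x
      rw [norm_sub_rev] at this
      linarith
    · linarith [hullValue_le_add_norm θ v hL j x y]
  have hcont : Continuous fun y => max (hullValue θ v L j y) c := by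
    have : LipschitzWith L.toNNReal fun y => max (hullValue θ v L j y) c :=
      LipschitzWith.of_dist_le_mul fun x y => by
        rw [Real.dist_eq, dist_eq_norm, Real.coe_toNNReal _ hL]
        exact hlip x (Set.mem_univ x) y (Set.mem_univ y)
    exact this.continuous
  refine ⟨⟨?_, ?_⟩, ?_, ?_, ?_, hlip, fun i => ?_⟩
  · obtain ⟨C, hC⟩ := hX.exists_bound_of_continuousOn hcont.continuousOn
    exact ⟨C, hC⟩
  · exact hcont.measurable.comp measurable_subtype_coe
  · exact fun x _ y _ h => max_le_max_right c (monotone_hullValue θ v hL j h)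
  · intro r
    by_cases h : r ≤ c
    · simp [h, convex_univ]
    · simpa [h] using (concaveOn_hullValue θ v hL j).quasiconcaveOn r
  · intro σ x _
    simp only [hullValue_permute θ v hL j σ x]
  · rcases le_or_gt i j with h | h
    · exact (le_hullValue_apply L h).trans (le_max_left _ _)
    · exact (hc i h).trans (le_max_right _ _)

/-! ### Counting linear inequalities -/

/-- The predicate `P` on `E` is the conjunction of a family of weak linear inequalities indexed by
`ι`. The number of inequalities is the cardinality of `ι`; an equation counts as two. -/
def IsLinearSystem {E : Type*} [AddCommGroup E] [Module ℝ E] (ι : Type*) (P : E → Prop) : Prop :=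
  ∃ (A : E →ₗ[ℝ] (ι → ℝ)) (b : ι → ℝ), ∀ e, P e ↔ A e ≤ b

namespace IsLinearSystem

variable {E : Type*} [AddCommGroup E] [Module ℝ E] {ι κ : Type*} {P Q : E → Prop}

theorem congr (h : IsLinearSystem ι P) (hPQ : ∀ e, Q e ↔ P e) : IsLinearSystem ι Q := by
  obtain ⟨A, b, hA⟩ := h
  exact ⟨A, b, fun e => (hPQ e).trans (hA e)⟩

theorem le (f : E →ₗ[ℝ] ℝ) (c : ℝ) : IsLinearSystem Unit fun e => f e ≤ c :=
  ⟨LinearMap.pi fun _ => f, fun _ => c, fun e => by simp [Pi.le_def]⟩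

theorem and (hP : IsLinearSystem ι P) (hQ : IsLinearSystem κ Q) :
    IsLinearSystem (ι ⊕ κ) fun e => P e ∧ Q e := by
  obtain ⟨A, b, hA⟩ := hP
  obtain ⟨B, c, hB⟩ := hQ
  refine ⟨LinearMap.pi (Sum.elim (fun i => LinearMap.proj i ∘ₗ A) fun i => LinearMap.proj i ∘ₗ B),
    Sum.elim b c, fun e => ?_⟩
  simp [hA, hB, Pi.le_def]

theorem all {α : Type*} {R : α → E → Prop} (h : ∀ a, IsLinearSystem ι (R a)) :
    IsLinearSystem (α × ι) fun e => ∀ a, R a e := by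
  choose A b hA using h
  exact ⟨LinearMap.pi fun s => LinearMap.proj s.2 ∘ₗ A s.1, fun s => b s.1 s.2,
    fun e => by simp [hA, Pi.le_def]⟩

theorem eq (f : E →ₗ[ℝ] ℝ) (c : ℝ) : IsLinearSystem (Unit ⊕ Unit) fun e => f e = c :=
  ((le f c).and (le (-f) (-c))).congr fun e => by simp [le_antisymm_iff]

end IsLinearSystem

/-- A joint linear system in `x` and in auxiliary variables of any finite index types of the right
sizes is a linear description. -/
theorem IsLinearSystem.hasLinearDescription {X S : Set (Outcome M K)} {ι κ : Type*} [Fintype ι]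
    [Fintype κ] {n c : ℕ} (hι : Fintype.card ι = c) (hκ : Fintype.card κ = n)
    {P : Outcome M K × (κ → ℝ) → Prop} (hP : IsLinearSystem ι P)
    (hS : S = {x | x ∈ X ∧ ∃ u, P (x, u)}) : HasLinearDescription X S n c := by
  obtain ⟨A, b, hA⟩ := hP
  let e : ι ≃ Fin c := Fintype.equivFinOfCardEq hι
  let g : κ ≃ Fin n := Fintype.equivFinOfCardEq hκ
  refine ⟨LinearMap.funLeft ℝ ℝ e.symm ∘ₗ A ∘ₗ LinearMap.inl ℝ _ _,
    LinearMap.funLeft ℝ ℝ e.symm ∘ₗ A ∘ₗ LinearMap.inr ℝ _ _ ∘ₗ LinearMap.funLeft ℝ ℝ g,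
    b ∘ e.symm, ?_⟩
  -- Reindexing rows by `e` and columns by `g` turns the system for `P` into the concrete one.
  have key : ∀ x (u : Fin n → ℝ), P (x, u ∘ g) ↔
      (LinearMap.funLeft ℝ ℝ e.symm ∘ₗ A ∘ₗ LinearMap.inl ℝ _ _) x +
        (LinearMap.funLeft ℝ ℝ e.symm ∘ₗ A ∘ₗ LinearMap.inr ℝ _ _ ∘ₗ LinearMap.funLeft ℝ ℝ g) u ≤
          b ∘ e.symm := by
    intro x u
    have h1 : (x, u ∘ g) = LinearMap.inl ℝ (Outcome M K) (κ → ℝ) x +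
        LinearMap.inr ℝ (Outcome M K) (κ → ℝ) (u ∘ g) := by simp
    rw [hA, h1, map_add, Pi.le_def, Pi.le_def, ← e.symm.forall_congr_right]
    rfl
  rw [hS]
  ext x
  refine and_congr_right fun _ => ⟨fun ⟨u, hu⟩ => ⟨u ∘ g.symm, (key _ _).1 ?_⟩,
    fun ⟨u, hu⟩ => ⟨u ∘ g, (key _ _).2 hu⟩⟩
  have hg : (u ∘ g.symm) ∘ g = u := by
    funext a
    exact congrArg u (g.symm_apply_apply a)
  rwa [hg]

theorem hasLinearDescription_dualPolyhedron (X : Set (Outcome M K)) (θ : Fin J → Outcome M K)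
    (v : Fin J → ℝ) (L υ : ℝ) (j : Fin J) :
    HasLinearDescription X (dualPolyhedron X θ v L υ j)
      ((j + 1) * (M ^ 2 + 1) + 1) (M * K + (j + 1) * (M ^ 2 + 4 * M + 1) + 4) := by
  have hcard : Fintype.card (Top j) = j + 1 := by
    rw [Fintype.card_of_subtype (Finset.Iic j) fun _ => Finset.mem_Iic, Fin.card_Iic]
  -- The auxiliary variables: `p i` at `(i, none)`, `ρ i m l` at `(i, some (m, l))`, and `q`.
  let κ := (Top j × Option (Fin M × Fin M)) ⊕ Unit
  let E := Outcome M K × (κ → ℝ)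
  let xc (m : Fin M) (k : Fin K) : E →ₗ[ℝ] ℝ :=
    LinearMap.proj k ∘ₗ LinearMap.proj m ∘ₗ LinearMap.fst ℝ _ _
  let uc (a : κ) : E →ₗ[ℝ] ℝ := LinearMap.proj a ∘ₗ LinearMap.snd ℝ _ _
  let pc (i : Top j) : E →ₗ[ℝ] ℝ := uc (Sum.inl (i, none))
  let rc (i : Top j) (m l : Fin M) : E →ₗ[ℝ] ℝ := uc (Sum.inl (i, some (m, l)))
  let qc : E →ₗ[ℝ] ℝ := uc (Sum.inr ())
  have hlevel := IsLinearSystem.le (L • qc - ∑ i : Top j, v i.1 • pc i) (-υ)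
  have hdom := IsLinearSystem.all fun k : Fin K => IsLinearSystem.all fun l : Fin M =>
    IsLinearSystem.le ((∑ i : Top j, ∑ m, θ i.1 m k • rc i m l) - xc l k - qc) 0
  have hsum := IsLinearSystem.eq (∑ i : Top j, pc i) 1
  have hp := IsLinearSystem.all fun i : Top j => IsLinearSystem.le (-pc i) 0
  have hq := IsLinearSystem.le (-qc) 0
  have hcol := IsLinearSystem.all fun i : Top j => IsLinearSystem.all fun l : Fin M =>
    IsLinearSystem.eq ((∑ m, rc i m l) - pc i) 0
  have hrow := IsLinearSystem.all fun i : Top j => IsLinearSystem.all fun m : Fin M =>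
    IsLinearSystem.eq ((∑ l, rc i m l) - pc i) 0
  have hr := IsLinearSystem.all fun i : Top j => IsLinearSystem.all fun m : Fin M =>
    IsLinearSystem.all fun l : Fin M => IsLinearSystem.le (-rc i m l) 0
  refine (hlevel.and (hdom.and (hsum.and (hp.and (hq.and
    (hcol.and (hrow.and hr))))))).hasLinearDescription ?_ ?_ ?_
  · simp only [Fintype.card_sum, Fintype.card_prod, Fintype.card_fin, Fintype.card_unit, hcard]
    ring
  · simp only [κ, Fintype.card_sum, Fintype.card_prod, Fintype.card_option, Fintype.card_fin,
      Fintype.card_unit, hcard]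
    ring
  · have hxc : ∀ m k x (u : κ → ℝ), xc m k (x, u) = x m k := fun _ _ _ _ => rfl
    have hpc : ∀ i x (u : κ → ℝ), pc i (x, u) = u (Sum.inl (i, none)) := fun _ _ _ => rfl
    have hrc : ∀ i m l x (u : κ → ℝ), rc i m l (x, u) = u (Sum.inl (i, some (m, l))) :=
      fun _ _ _ _ _ => rfl
    have hqc : ∀ x (u : κ → ℝ), qc (x, u) = u (Sum.inr ()) := fun _ _ => rfl
    ext x
    refine and_congr_right fun _ => ⟨?_, ?_⟩
    · rintro ⟨p, q, ρ, h⟩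
      refine ⟨Sum.elim (fun a => a.2.elim (p a.1) fun s => ρ a.1 s.1 s.2) fun _ => q, ?_⟩
      have h2 := h.dominate
      simp only [Finset.sum_apply, Matrix.mulVec, dotProduct, Matrix.transpose_apply,
        mul_comm (ρ _ _ _)] at h2
      simp only [LinearMap.sub_apply, LinearMap.smul_apply, LinearMap.sum_apply,
        LinearMap.neg_apply, smul_eq_mul, hxc, hpc, hrc, hqc, Sum.elim_inl, Sum.elim_inr,
        sub_eq_zero, neg_nonpos, sub_nonpos]
      refine ⟨?_, h2, h.p_sum, h.p_nonneg, h.q_nonneg, h.col_sum, h.row_sum, h.ρ_nonneg⟩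
      have := h.level
      simp only [Option.elim_none]
      linarith
    · rintro ⟨u, hu⟩
      simp only [LinearMap.sub_apply, LinearMap.smul_apply, LinearMap.sum_apply,
        LinearMap.neg_apply, smul_eq_mul, hxc, hpc, hrc, hqc, sub_eq_zero, neg_nonpos,
        sub_nonpos] at hu
      obtain ⟨h1, h2, h3, h4, h5, h6, h7, h8⟩ := hu
      refine ⟨fun i => u (Sum.inl (i, none)), u (Sum.inr ()),
        fun i => Matrix.of fun m l => u (Sum.inl (i, some (m, l))), by linarith, ?_, h3, h4, h5,
        h6, h7, h8⟩
      simpa only [Finset.sum_apply, Matrix.mulVec, dotProduct, Matrix.transpose_apply,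
        Matrix.of_apply, mul_comm (u _)] using h2

/-! ### Upper level sets of the worst-case valuations -/

theorem worstCase_le {X Y : Set (Outcome M K)} (hJ : 0 < J) (hY : Convex ℝ Y)
    {θ : Fin J → Outcome M K} (hθ : ∀ i, θ i ∈ Y) {v : Fin J → ℝ} {L : ℝ} (hL : 0 ≤ L)
    {f : Outcome M K → ℝ} (hf : f ∈ ambiguitySet X Y θ v L) {x : Outcome M K} (hx : x ∈ Y) :
    worstCase (ambiguitySet X Y θ v L) x ≤ f x :=
  (isGLB_worstCase hJ hY θ hθ v hL hx).2.1 ⟨f, hf, rfl⟩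

/-- Valuations of all outcomes restrict to valuations on a convex and permutation stable set. -/
theorem ambiguitySet_univ_subset {X : Set (Outcome M K)} (hX : Convex ℝ X)
    {θ : Fin J → Outcome M K} {v : Fin J → ℝ} {L : ℝ} :
    ambiguitySet X Set.univ θ v L ⊆ ambiguitySet X X θ v L := by
  rintro f ⟨hbm, hmono, hqc, hperm, hlip, hval⟩
  refine ⟨hbm, hmono.mono (Set.subset_univ X), fun r => ?_, fun σ x _ => hperm σ x trivial,
    fun x _ y _ => hlip x trivial y trivial, hval⟩
  have := hX.inter (hqc r)
  convert this using 1
  ext x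
  simp

/-- If the linear system has no solution at `x`, then `hullValue`, cut off at a level `c < υ` that
dominates the data after `j`, is a valuation in the ambiguity set with value below `υ` at `x`. -/
theorem upperLevelSet_worstCase_subset {X Y : Set (Outcome M K)} (hXcompact : IsCompact X)
    (hJ : 0 < J) (hY : Convex ℝ Y) (hXY : X ⊆ Y) {θ : Fin J → Outcome M K}
    (hθ : ∀ i, θ i ∈ X) {v : Fin J → ℝ} (hv : Antitone v) {L : ℝ} (hL : 0 ≤ L) {υ : ℝ}
    {j : Fin J} (hj : j ∈ levelSelection v υ)
    (hsub : ambiguitySet X Set.univ θ v L ⊆ ambiguitySet X Y θ v L) :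
    upperLevelSet X (worstCase (ambiguitySet X Y θ v L)) υ ⊆ dualPolyhedron X θ v L υ j := by
  rintro x ⟨hx, hxυ⟩
  refine ⟨hx, (le_hullValue_iff hL).1 ?_⟩
  obtain ⟨c, hcυ, hc⟩ : ∃ c < υ, ∀ i, j < i → v i ≤ c := by
    by_cases h : (j : ℕ) + 1 < J
    · exact ⟨v ⟨j + 1, h⟩, hj.2 h, fun i hi => hv (Fin.mk_le_of_le_val hi)⟩
    · exact ⟨υ - 1, by linarith, fun i hi => absurd hi (by rw [Fin.lt_def]; omega)⟩
  have h := hxυ.trans (worstCase_le hJ hY (fun i => hXY (hθ i)) hL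
    (hsub (max_hullValue_mem_ambiguitySet θ v hL j hXcompact hc)) (hXY hx))
  exact (le_max_iff.1 h).resolve_right (not_le.2 hcυ)

theorem dualPolyhedron_subset {X Y : Set (Outcome M K)} (hJ : 0 < J) (hY : Convex ℝ Y)
    (hYperm : IsPermStable Y) (hXY : X ⊆ Y) {θ : Fin J → Outcome M K} (hθ : ∀ i, θ i ∈ X)
    {v : Fin J → ℝ} (hv : Antitone v) {L : ℝ} (hL : 0 ≤ L) {υ : ℝ} {j : Fin J}
    (hj : j ∈ levelSelection v υ) (hshift : 0 < L → ∀ i ≤ j, shiftedPoint θ v L υ i ∈ Y) :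
    dualPolyhedron X θ v L υ j ⊆ upperLevelSet X (worstCase (ambiguitySet X Y θ v L)) υ := by
  rintro x ⟨hx, hfeas⟩
  have hθY : ∀ i, θ i ∈ Y := fun i => hXY (hθ i)
  refine ⟨hx, (isGLB_worstCase hJ hY θ hθY v hL (hXY hx)).2.2 ?_⟩
  rintro _ ⟨f, hf, rfl⟩
  exact le_of_exists_isFeasible hYperm hθY hL (fun i hi => hj.1.trans (hv hi)) hshift hf
    (hXY hx) hfeas

end PermInv

theorem mainTheorem9 {M K J : ℕ} (hM : 1 ≤ M) (hK : 1 ≤ K) (hJ : 1 ≤ J)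
    (X : Set (PermInv.Outcome M K)) (hXcompact : IsCompact X) (hXconvex : Convex ℝ X)
    (hXperm : PermInv.IsPermStable X)
    (θ : Fin J → PermInv.Outcome M K) (hθ : ∀ i, θ i ∈ X)
    (v : Fin J → ℝ) (hv : Antitone v) (L : ℝ) (hL : 0 ≤ L)
    (υ : ℝ) (hυ : υ ≤ PermInv.levelMax v) :
    ∃ j : Fin J, PermInv.levelSelection v υ = {j} ∧
      -- valuations defined for all outcomes
      PermInv.upperLevelSet X
          (PermInv.worstCase (PermInv.ambiguitySet X Set.univ θ v L)) υ =
        PermInv.dualPolyhedron X θ v L υ j ∧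
      -- valuations defined on `X` only
      PermInv.upperLevelSet X
          (PermInv.worstCase (PermInv.ambiguitySet X X θ v L)) υ ⊆
        PermInv.dualPolyhedron X θ v L υ j ∧
      ((0 < L → ∀ i ≤ j, PermInv.shiftedPoint θ v L υ i ∈ X) →
        PermInv.upperLevelSet X
            (PermInv.worstCase (PermInv.ambiguitySet X X θ v L)) υ =
          PermInv.dualPolyhedron X θ v L υ j) ∧
      -- size of the linear description, with `j + 1` selected data points
      PermInv.HasLinearDescription X (PermInv.dualPolyhedron X θ v L υ j)
        ((j + 1) * (M ^ 2 + 1) + 1)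
        (M * K + (j + 1) * (M ^ 2 + 4 * M + 1) + 4) := by
  obtain ⟨j, hj⟩ := PermInv.existsUnique_levelSelection hJ hv hυ
  have hjm : j ∈ PermInv.levelSelection v υ := hj ▸ Set.mem_singleton j
  have hsubX := PermInv.upperLevelSet_worstCase_subset hXcompact hJ hXconvex subset_rfl hθ hv hL
    hjm (PermInv.ambiguitySet_univ_subset hXconvex)
  refine ⟨j, hj, ?_, hsubX, fun hshift => hsubX.antisymm ?_,
    PermInv.hasLinearDescription_dualPolyhedron X θ v L υ j⟩
  · exact (PermInv.upperLevelSet_worstCase_subset hXcompact hJ convex_univ (Set.subset_univ X) hθ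
      hv hL hjm subset_rfl).antisymm (PermInv.dualPolyhedron_subset hJ convex_univ
        (fun _ _ _ => trivial) (Set.subset_univ X) hθ hv hL hjm fun _ _ _ => trivial)
  · exact PermInv.dualPolyhedron_subset hJ hXconvex hXperm subset_rfl hθ hv hL hjm hshift
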